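/- Let $\mathcal R=(\omega,\mathcal P(\omega),+,\cdot,<,\in,0,1)$ be the full standard model of second-order arithmetic; elements of $\mathcal P(\omega)$ are called reals. For a set $A$ of reals, a property over $A$ is a formula $\phi(x)$ of the two-sorted language $\{+,\cdot,<,\in,0,1\}$ (with equality) with parameters from $A$, whose only free variable is the set variable $x$; its extension is $ext(\phi)=\{x\in\mathcal P(\omega):\mathcal R\models\phi(x)\}$. The property is $A$-typical if $|ext(\phi)|>|\mathcal P(\omega)\setminus ext(\phi)|$, and a real $a$ is $A$-typical if it satisfies every $A$-typical property. For a finite tuple $\overline c=(c_1,\dots,c_n)$ of reals (possibly empty), $\mathsf{Tp}(a,\overline c)$ means that $a$ is $\{c_1,\dots,c_n\}$-typical. Let $\leq_T$ and $\equiv_T$ denote Turing reducibility and Turing equivalence, and let $a'=\{e\in\omega:\Phi^a_e(e)\downarrow\}$ be the Turing jump of $a$, where $(\Phi_e^a)_{e\in\omega}$ is the standard enumeration of the partial functions recursive in $a$. Theorem. For all reals $a,b$ and every finite tuple $\overline c$ of reals: (i) if $\neg\mathsf{Tp}(a,\overline c)$ and $b\leq_T a$, then $\neg\mathsf{Tp}(b,\overline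 c)$; (ii) if $\mathsf{Tp}(a,\overline c)$ and $b\equiv_T a$, then $\mathsf{Tp}(b,\overline c)$; (iii) $\mathsf{Tp}(a,\overline c)\Leftrightarrow\mathsf{Tp}(a',\overline c)$. -/

import Mathlib

/-! ## The language of second-order arithmetic and its full standard model -/

namespace SecondOrderArith

/-- Number terms of the two-sorted language `{+, ·, <, ∈, 0, 1}`, with free number variables among
`k` de Bruijn variables. -/
inductive NumTerm (k : ℕ) : Type
  | var (i : Fin k) : NumTerm k
  | zero : NumTerm k
  | one : NumTerm k
  | add (s t : NumTerm k) : NumTerm k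
  | mul (s t : NumTerm k) : NumTerm k

/-- Set terms: a set variable (one of `m` de Bruijn variables), or a parameter naming an element
of `A`. -/
inductive SetTerm (A : Set (Set ℕ)) (m : ℕ) : Type
  | var (i : Fin m) : SetTerm A m
  | param (p : A) : SetTerm A m

/-- Formulas of the two-sorted language `{+, ·, <, ∈, 0, 1}` (first-order logic with equality)
with parameters from `A`, whose free number variables are among `k` variables and whose free set
variables are among `m` variables. A quantifier binds variable `0` of its scope. The other
connectives and `∃` are the usual classical abbreviations. -/
inductive SOFormula (A : Set (Set ℕ)) : ℕ → ℕ → Type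
  | falsum {k m : ℕ} : SOFormula A k m
  | numEq {k m : ℕ} (s t : NumTerm k) : SOFormula A k m
  | numLt {k m : ℕ} (s t : NumTerm k) : SOFormula A k m
  | setEq {k m : ℕ} (x y : SetTerm A m) : SOFormula A k m
  | mem {k m : ℕ} (t : NumTerm k) (x : SetTerm A m) : SOFormula A k m
  | imp {k m : ℕ} (φ ψ : SOFormula A k m) : SOFormula A k m
  | allNum {k m : ℕ} (φ : SOFormula A (k + 1) m) : SOFormula A k m
  | allSet {k m : ℕ} (φ : SOFormula A k (m + 1)) : SOFormula A k m

/-- Value of a number term in the standard model. -/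
def NumTerm.value {k : ℕ} (v : Fin k → ℕ) : NumTerm k → ℕ
  | .var i => v i
  | .zero => 0
  | .one => 1
  | .add s t => s.value v + t.value v
  | .mul s t => s.value v * t.value v

/-- Value of a set term in the standard model; each parameter denotes itself. -/
def SetTerm.value {A : Set (Set ℕ)} {m : ℕ} (w : Fin m → Set ℕ) : SetTerm A m → Set ℕ
  | .var i => w i
  | .param p => (p : Set ℕ)

/-- Tarskian satisfaction in the full standard model `(ω, 𝒫(ω), +, ·, <, ∈, 0, 1)`: number
quantifiers range over `ℕ` and set quantifiers over all of `Set ℕ`. -/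
def SOFormula.Sat {A : Set (Set ℕ)} :
    {k m : ℕ} → SOFormula A k m → (Fin k → ℕ) → (Fin m → Set ℕ) → Prop
  | _, _, .falsum, _, _ => False
  | _, _, .numEq s t, v, _ => s.value v = t.value v
  | _, _, .numLt s t, v, _ => s.value v < t.value v
  | _, _, .setEq x y, _, w => x.value w = y.value w
  | _, _, .mem t x, v, w => t.value v ∈ x.value w
  | _, _, .imp φ ψ, v, w => φ.Sat v w → ψ.Sat v w
  | _, _, .allNum φ, v, w => ∀ n : ℕ, φ.Sat (Fin.cons n v) w
  | _, _, .allSet φ, v, w => ∀ x : Set ℕ, φ.Sat v (Fin.cons x w)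

/-- The extension of a property `φ(x)` with parameters from `A`, i.e. a formula whose only free
variable is one set variable: the set of reals satisfying it. -/
def ext {A : Set (Set ℕ)} (φ : SOFormula A 0 1) : Set (Set ℕ) :=
  {x | φ.Sat Fin.elim0 (fun _ => x)}

end SecondOrderArith

/-! ## Typicality -/

/-- The majority subsets of `M`: those having strictly more elements than their complement. -/
def majority (M : Type*) : Set (Set M) :=
  {X | Cardinal.mk ↥Xᶜ < Cardinal.mk ↥X}

/-- A property with parameters from `A` is `A`-typical if its extension is a majority subset of
the set of all reals. -/
def IsTypicalProperty {A : Set (Set ℕ)} (φ : SecondOrderArith.SOFormula A 0 1) : Prop :=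
  SecondOrderArith.ext φ ∈ majority (Set ℕ)

/-- A real is `A`-typical if it satisfies every `A`-typical property. -/
def IsTypicalOver (A : Set (Set ℕ)) (a : Set ℕ) : Prop :=
  ∀ φ : SecondOrderArith.SOFormula A 0 1, IsTypicalProperty φ → a ∈ SecondOrderArith.ext φ

/-- Relative typicality `Tp(a, c̄)` of a real with respect to a finite tuple of reals. -/
def Tp {n : ℕ} (a : Set ℕ) (c : Fin n → Set ℕ) : Prop :=
  IsTypicalOver (Set.range c) a

/-! ## Turing reducibility and the jump -/

/-- The characteristic function of a set of natural numbers, as a (total) partial function. -/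
noncomputable def charFun (a : Set ℕ) : ℕ →. ℕ :=
  ((a.indicator 1 : ℕ → ℕ) : ℕ →. ℕ)

/-- Programs for partial functions recursive in an oracle; one constructor for each clause of
`Nat.RecursiveIn`. -/
inductive OracleCode : Type
  | zero : OracleCode
  | succ : OracleCode
  | left : OracleCode
  | right : OracleCode
  | oracle : OracleCode
  | pair (c d : OracleCode) : OracleCode
  | comp (c d : OracleCode) : OracleCode
  | prec (c d : OracleCode) : OracleCode
  | rfind (c : OracleCode) : OracleCode

namespace OracleCode

/-- The partial function computed by a program with oracle `g`. -/
def eval (g : ℕ →. ℕ) : OracleCode → ℕ →. ℕ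
  | zero => fun _ => Part.some 0
  | succ => fun n => Part.some (n + 1)
  | left => fun n => Part.some n.unpair.1
  | right => fun n => Part.some n.unpair.2
  | oracle => g
  | pair c d => fun n => Nat.pair <$> c.eval g n <*> d.eval g n
  | comp c d => fun n => d.eval g n >>= c.eval g
  | prec c d => fun p =>
      p.unpair.2.rec (c.eval g p.unpair.1) fun y IH => do
        let i ← IH
        d.eval g (Nat.pair p.unpair.1 (Nat.pair y i))
  | rfind c => fun a => Nat.rfind fun n => (fun m => decide (m = 0)) <$> c.eval g (Nat.pair a n)

/-- The standard (effective, bijective) numbering of programs: `ofNat e` is the `e`-th program. -/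
def ofNat : ℕ → OracleCode
  | 0 => zero
  | 1 => succ
  | 2 => left
  | 3 => right
  | 4 => oracle
  | n + 5 =>
    have h0 : n / 4 < n + 5 := by omega
    have h1 : (n / 4).unpair.1 < n + 5 := (Nat.unpair_left_le _).trans_lt h0
    have h2 : (n / 4).unpair.2 < n + 5 := (Nat.unpair_right_le _).trans_lt h0
    match n % 4 with
    | 0 => pair (ofNat (n / 4).unpair.1) (ofNat (n / 4).unpair.2)
    | 1 => comp (ofNat (n / 4).unpair.1) (ofNat (n / 4).unpair.2)
    | 2 => prec (ofNat (n / 4).unpair.1) (ofNat (n / 4).unpair.2)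
    | _ => rfind (ofNat (n / 4))

end OracleCode

/-- `Φ_e^a`, the `e`-th partial function recursive in the set `a`. -/
noncomputable def Phi (e : ℕ) (a : Set ℕ) : ℕ →. ℕ :=
  (OracleCode.ofNat e).eval (charFun a)

/-- The Turing jump `a' = {e : Φ_e^a(e)↓}`. -/
def turingJump (a : Set ℕ) : Set ℕ :=
  {e | (Phi e a e).Dom}

/-!
A real is non-typical over `A` exactly when it lies in an `A`-definable set of fewer than continuum
many reals (`not_isTypicalOver_iff`). If `R` is the graph of a definable partial function from
reals to reals, then the `R`-image of such a set is again definable and not larger, so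
non-typicality passes from `a` to `b` whenever `R a b` (`not_isTypicalOver_of_definable`). All
three claims are instances of this principle.

* If `b ≤_T a`, fix an index `e` with `b = {n | Φ_e^a(n) = 1}`; the map `x ↦ {n | Φ_e^x(n) = 1}` is
  definable and total.
* The jump `x ↦ x'` is definable, and so is its graph read backwards, which is the graph of a
  partial function because the jump is injective (`turingJump_injective`).

What has to be shown is that `Φ` is definable. Its graph is the least set of codes `⟨e, ⟨n, r⟩⟩`
closed under the computation rules (`mem_Phi_iff`), and it is therefore defined by a quantifier over
all sets closed under them. Besides the oracle, the rules mention only sums, products and the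
pairing function, which is arithmetical, so that no coding of finite sequences is needed.
-/

/-! ### Definable relations of second-order arithmetic -/

namespace SecondOrderArith

variable {A : Set (Set ℕ)} {k m : ℕ}

/-- A relation between `k` numbers and `m` reals is definable with parameters from `A` if some
formula with `k` free number variables and `m` free set variables defines it in the full standard
model. -/
def Definable (A : Set (Set ℕ)) {k m : ℕ} (R : (Fin k → ℕ) → (Fin m → Set ℕ) → Prop) : Prop :=
  ∃ φ : SOFormula A k m, ∀ v w, φ.Sat v w ↔ R v w

/-- A number-valued function of `k` numbers and `m` reals is definable if its graph is; the value
is variable `0` of the defining formula. -/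
def DefinableFun (A : Set (Set ℕ)) {k m : ℕ} (f : (Fin k → ℕ) → (Fin m → Set ℕ) → ℕ) : Prop :=
  Definable A fun (v : Fin (k + 1) → ℕ) w ↦ v 0 = f (fun i ↦ v i.succ) w

theorem NumTerm.exists_rename {k' : ℕ} (ρ : Fin k → Fin k') (t : NumTerm k) :
    ∃ t' : NumTerm k', ∀ v, t'.value v = t.value fun i ↦ v (ρ i) := by
  induction t with
  | var i => exact ⟨.var (ρ i), fun _ ↦ rfl⟩
  | zero => exact ⟨.zero, fun _ ↦ rfl⟩
  | one => exact ⟨.one, fun _ ↦ rfl⟩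
  | add s t hs ht =>
    obtain ⟨s', hs⟩ := hs
    obtain ⟨t', ht⟩ := ht
    exact ⟨.add s' t', fun v ↦ by simp [NumTerm.value, hs, ht]⟩
  | mul s t hs ht =>
    obtain ⟨s', hs⟩ := hs
    obtain ⟨t', ht⟩ := ht
    exact ⟨.mul s' t', fun v ↦ by simp [NumTerm.value, hs, ht]⟩

theorem SetTerm.exists_rename {m' : ℕ} (σ : Fin m → Fin m') (t : SetTerm A m) :
    ∃ t' : SetTerm A m', ∀ w, t'.value w = t.value fun i ↦ w (σ i) := by
  cases t with
  | var i => exact ⟨.var (σ i), fun _ ↦ rfl⟩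
  | param p => exact ⟨.param p, fun _ ↦ rfl⟩

theorem SOFormula.exists_rename (φ : SOFormula A k m) :
    ∀ {k' m' : ℕ} (ρ : Fin k → Fin k') (σ : Fin m → Fin m'),
      ∃ φ' : SOFormula A k' m', ∀ v w,
        φ'.Sat v w ↔ φ.Sat (fun i ↦ v (ρ i)) (fun i ↦ w (σ i)) := by
  induction φ with
  | falsum => exact fun _ _ ↦ ⟨.falsum, fun _ _ ↦ Iff.rfl⟩
  | numEq s t =>
    intro _ _ ρ _
    obtain ⟨s', hs⟩ := s.exists_rename ρ
    obtain ⟨t', ht⟩ := t.exists_rename ρ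
    exact ⟨.numEq s' t', fun v w ↦ by simp [SOFormula.Sat, hs, ht]⟩
  | numLt s t =>
    intro _ _ ρ _
    obtain ⟨s', hs⟩ := s.exists_rename ρ
    obtain ⟨t', ht⟩ := t.exists_rename ρ
    exact ⟨.numLt s' t', fun v w ↦ by simp [SOFormula.Sat, hs, ht]⟩
  | setEq x y =>
    intro _ _ _ σ
    obtain ⟨x', hx⟩ := x.exists_rename σ
    obtain ⟨y', hy⟩ := y.exists_rename σ
    exact ⟨.setEq x' y', fun v w ↦ by simp [SOFormula.Sat, hx, hy]⟩
  | mem t x =>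
    intro _ _ ρ σ
    obtain ⟨t', ht⟩ := t.exists_rename ρ
    obtain ⟨x', hx⟩ := x.exists_rename σ
    exact ⟨.mem t' x', fun v w ↦ by simp [SOFormula.Sat, ht, hx]⟩
  | imp φ ψ hφ hψ =>
    intro _ _ ρ σ
    obtain ⟨φ', hφ⟩ := hφ ρ σ
    obtain ⟨ψ', hψ⟩ := hψ ρ σ
    exact ⟨.imp φ' ψ', fun v w ↦ by simp [SOFormula.Sat, hφ, hψ]⟩
  | allNum φ hφ =>
    intro _ _ ρ σ
    obtain ⟨φ', hφ⟩ := hφ (Fin.cons 0 fun i ↦ (ρ i).succ) σ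
    refine ⟨.allNum φ', fun v w ↦ forall_congr' fun n ↦ (hφ _ _).trans (iff_of_eq ?_)⟩
    congr 1
    funext i
    cases i using Fin.cases <;> rfl
  | allSet φ hφ =>
    intro _ _ ρ σ
    obtain ⟨φ', hφ⟩ := hφ ρ (Fin.cons 0 fun i ↦ (σ i).succ)
    refine ⟨.allSet φ', fun v w ↦ forall_congr' fun n ↦ (hφ _ _).trans (iff_of_eq ?_)⟩
    congr 1
    funext i
    cases i using Fin.cases <;> rfl

namespace Definable

variable {P Q : (Fin k → ℕ) → (Fin m → Set ℕ) → Prop}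

theorem rename {k' m' : ℕ} (ρ : Fin k → Fin k') (σ : Fin m → Fin m') (h : Definable A P) :
    Definable A fun v w ↦ P (fun i ↦ v (ρ i)) (fun i ↦ w (σ i)) := by
  obtain ⟨φ, hφ⟩ := h
  obtain ⟨φ', hφ'⟩ := φ.exists_rename ρ σ
  exact ⟨φ', fun v w ↦ (hφ' v w).trans (hφ _ _)⟩

theorem congr (h : Definable A P) (hPQ : ∀ v w, P v w ↔ Q v w) : Definable A Q := by
  obtain ⟨φ, hφ⟩ := h
  exact ⟨φ, fun v w ↦ (hφ v w).trans (hPQ v w)⟩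

theorem imp (hP : Definable A P) (hQ : Definable A Q) :
    Definable A fun v w ↦ P v w → Q v w := by
  obtain ⟨φ, hφ⟩ := hP
  obtain ⟨ψ, hψ⟩ := hQ
  exact ⟨.imp φ ψ, fun v w ↦ imp_congr (hφ v w) (hψ v w)⟩

theorem not (hP : Definable A P) : Definable A fun v w ↦ ¬ P v w :=
  hP.imp ⟨.falsum, fun _ _ ↦ Iff.rfl⟩

theorem and (hP : Definable A P) (hQ : Definable A Q) :
    Definable A fun v w ↦ P v w ∧ Q v w :=
  (hP.imp hQ.not).not.congr fun v w ↦ by tauto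

theorem or (hP : Definable A P) (hQ : Definable A Q) :
    Definable A fun v w ↦ P v w ∨ Q v w :=
  (hP.not.imp hQ).congr fun v w ↦ by tauto

theorem iff (hP : Definable A P) (hQ : Definable A Q) :
    Definable A fun v w ↦ (P v w ↔ Q v w) :=
  ((hP.imp hQ).and (hQ.imp hP)).congr fun v w ↦ by tauto

theorem forallNum {P : ℕ → (Fin k → ℕ) → (Fin m → Set ℕ) → Prop}
    (h : Definable A fun (v : Fin (k + 1) → ℕ) w ↦ P (v 0) (fun i ↦ v i.succ) w) :
    Definable A fun v w ↦ ∀ n, P n v w := by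
  obtain ⟨φ, hφ⟩ := h
  exact ⟨.allNum φ, fun v w ↦ forall_congr' fun n ↦ hφ (Fin.cons n v) w⟩

theorem forallSet {P : Set ℕ → (Fin k → ℕ) → (Fin m → Set ℕ) → Prop}
    (h : Definable A fun v (w : Fin (m + 1) → Set ℕ) ↦ P (w 0) v (fun i ↦ w i.succ)) :
    Definable A fun v w ↦ ∀ x, P x v w := by
  obtain ⟨φ, hφ⟩ := h
  exact ⟨.allSet φ, fun v w ↦ forall_congr' fun x ↦ hφ v (Fin.cons x w)⟩

theorem existsNum {P : ℕ → (Fin k → ℕ) → (Fin m → Set ℕ) → Prop}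
    (h : Definable A fun (v : Fin (k + 1) → ℕ) w ↦ P (v 0) (fun i ↦ v i.succ) w) :
    Definable A fun v w ↦ ∃ n, P n v w :=
  (forallNum (P := fun n v w ↦ ¬ P n v w) h.not).not.congr fun v w ↦ by simp

theorem existsSet {P : Set ℕ → (Fin k → ℕ) → (Fin m → Set ℕ) → Prop}
    (h : Definable A fun v (w : Fin (m + 1) → Set ℕ) ↦ P (w 0) v (fun i ↦ w i.succ)) :
    Definable A fun v w ↦ ∃ x, P x v w :=
  (forallSet (P := fun x v w ↦ ¬ P x v w) h.not).not.congr fun v w ↦ by simp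

/-- Substitution of a definable function for a number variable. -/
theorem subst {f : (Fin k → ℕ) → (Fin m → Set ℕ) → ℕ}
    {P : ℕ → (Fin k → ℕ) → (Fin m → Set ℕ) → Prop}
    (h : Definable A fun (v : Fin (k + 1) → ℕ) w ↦ P (v 0) (fun i ↦ v i.succ) w)
    (hf : DefinableFun A f) : Definable A fun v w ↦ P (f v w) v w :=
  (existsNum (P := fun n v w ↦ n = f v w ∧ P n v w) (hf.and h)).congr fun v w ↦ by simp

end Definable

theorem DefinableFun.weaken {f : (Fin k → ℕ) → (Fin m → Set ℕ) → ℕ} (hf : DefinableFun A f) :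
    DefinableFun A fun (v : Fin (k + 1) → ℕ) w ↦ f (fun i ↦ v i.succ) w :=
  Definable.rename (Fin.cons 0 fun i ↦ i.succ.succ) id hf

namespace Definable

variable {f g : (Fin k → ℕ) → (Fin m → Set ℕ) → ℕ}

theorem subst₂ {P : ℕ → ℕ → (Fin k → ℕ) → (Fin m → Set ℕ) → Prop}
    (h : Definable A fun (v : Fin (k + 2) → ℕ) w ↦ P (v 1) (v 0) (fun i ↦ v i.succ.succ) w)
    (hf : DefinableFun A f) (hg : DefinableFun A g) :
    Definable A fun v w ↦ P (f v w) (g v w) v w :=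
  subst (P := fun a v w ↦ P a (g v w) v w)
    (subst (P := fun b (v : Fin (k + 1) → ℕ) w ↦ P (v 0) b (fun i ↦ v i.succ) w) h hg.weaken) hf

theorem eq (hf : DefinableFun A f) (hg : DefinableFun A g) :
    Definable A fun v w ↦ f v w = g v w :=
  subst₂ (P := fun a b _ _ ↦ a = b) ⟨.numEq (.var 1) (.var 0), fun _ _ ↦ Iff.rfl⟩ hf hg

theorem lt (hf : DefinableFun A f) (hg : DefinableFun A g) :
    Definable A fun v w ↦ f v w < g v w :=
  subst₂ (P := fun a b _ _ ↦ a < b) ⟨.numLt (.var 1) (.var 0), fun _ _ ↦ Iff.rfl⟩ hf hg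

theorem mem (hf : DefinableFun A f) (i : Fin m) : Definable A fun v w ↦ f v w ∈ w i :=
  subst (P := fun a _ w ↦ a ∈ w i) ⟨.mem (.var 0) (.var i), fun _ _ ↦ Iff.rfl⟩ hf

end Definable

namespace DefinableFun

variable {f g : (Fin k → ℕ) → (Fin m → Set ℕ) → ℕ}

theorem var (i : Fin k) : DefinableFun A fun v (_ : Fin m → Set ℕ) ↦ v i :=
  ⟨.numEq (.var 0) (.var i.succ), fun _ _ ↦ Iff.rfl⟩

theorem add (hf : DefinableFun A f) (hg : DefinableFun A g) :
    DefinableFun A fun v w ↦ f v w + g v w :=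
  Definable.subst₂ (P := fun a b (v : Fin (k + 1) → ℕ) _ ↦ v 0 = a + b)
    ⟨.numEq (.var 2) (.add (.var 1) (.var 0)), fun _ _ ↦ Iff.rfl⟩ hf.weaken hg.weaken

theorem mul (hf : DefinableFun A f) (hg : DefinableFun A g) :
    DefinableFun A fun v w ↦ f v w * g v w :=
  Definable.subst₂ (P := fun a b (v : Fin (k + 1) → ℕ) _ ↦ v 0 = a * b)
    ⟨.numEq (.var 2) (.mul (.var 1) (.var 0)), fun _ _ ↦ Iff.rfl⟩ hf.weaken hg.weaken

theorem const (n : ℕ) :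
    DefinableFun A fun (_ : Fin k → ℕ) (_ : Fin m → Set ℕ) ↦ n := by
  induction n with
  | zero => exact ⟨.numEq (.var 0) .zero, fun _ _ ↦ Iff.rfl⟩
  | succ n ih => exact ih.add ⟨.numEq (.var 0) .one, fun _ _ ↦ Iff.rfl⟩

theorem pair (hf : DefinableFun A f) (hg : DefinableFun A g) :
    DefinableFun A fun v w ↦ Nat.pair (f v w) (g v w) := by
  refine Definable.subst₂ (P := fun a b (v : Fin (k + 1) → ℕ) _ ↦ v 0 = Nat.pair a b)
    ?_ hf.weaken hg.weaken
  have h : Definable A fun (v : Fin (k + 3) → ℕ) (_ : Fin m → Set ℕ) ↦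
      (v 1 < v 0 ∧ v 2 = v 0 * v 0 + v 1) ∨ (¬ v 1 < v 0 ∧ v 2 = v 1 * v 1 + v 1 + v 0) :=
    .or
      (.and (.lt (var 1) (var 0)) (.eq (var 2) (((var 0).mul (var 0)).add (var 1))))
      (.and (.not (.lt (var 1) (var 0)))
        (.eq (var 2) ((((var 1).mul (var 1)).add (var 1)).add (var 0))))
  refine h.congr fun v w ↦ ?_
  change _ ↔ v 2 = Nat.pair (v 1) (v 0)
  unfold Nat.pair
  split_ifs with hlt <;> simp [hlt]

end DefinableFun

end SecondOrderArith

/-! ### Non-typical reals and definable partial functions -/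

open SecondOrderArith in
/-- A real is non-typical exactly when it belongs to a definable set of fewer than continuum many
reals, since the complement of such a set has continuum many elements. -/
theorem not_isTypicalOver_iff {A : Set (Set ℕ)} {a : Set ℕ} :
    ¬ IsTypicalOver A a ↔
      ∃ φ : SOFormula A 0 1, a ∈ ext φ ∧ Cardinal.mk (ext φ) < Cardinal.mk (Set ℕ) := by
  simp only [IsTypicalOver, IsTypicalProperty, majority, Set.mem_ofPred_eq, not_forall,
    exists_prop]
  constructor
  · rintro ⟨φ, h, ha⟩
    refine ⟨.imp φ .falsum, ha, ?_⟩
    exact h.trans_le (Cardinal.mk_set_le _)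
  · rintro ⟨φ, ha, h⟩
    refine ⟨.imp φ .falsum, ?_, fun h' ↦ h' ha⟩
    have e : ext (.imp φ .falsum) = (ext φ)ᶜ := rfl
    rwa [e, compl_compl, Cardinal.mk_compl_of_infinite _ h]

open SecondOrderArith in
/-- The image of a definable set under a definable partial function on the reals is definable and
not larger than the set, so that non-typicality is inherited by images. -/
theorem not_isTypicalOver_of_definable {A : Set (Set ℕ)} {R : Set ℕ → Set ℕ → Prop}
    (hR : Definable A fun (_ : Fin 0 → ℕ) (w : Fin 2 → Set ℕ) ↦ R (w 0) (w 1))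
    (hfun : ∀ x y y', R x y → R x y' → y = y') {a b : Set ℕ} (hab : R a b)
    (ha : ¬ IsTypicalOver A a) : ¬ IsTypicalOver A b := by
  rw [not_isTypicalOver_iff] at ha ⊢
  obtain ⟨φ, haφ, hφ⟩ := ha
  have h : Definable A fun (v : Fin 0 → ℕ) (w : Fin 1 → Set ℕ) ↦
      ∃ x, φ.Sat v (fun _ ↦ x) ∧ R x (w 0) :=
    Definable.existsSet <|
      Definable.and (Definable.rename id (fun _ ↦ 0) ⟨φ, fun _ _ ↦ Iff.rfl⟩) hR
  obtain ⟨ψ, hψ⟩ := h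
  refine ⟨ψ, (hψ _ _).2 ⟨a, haφ, hab⟩, ?_⟩
  -- each image point is sent to one of its preimages, injectively because `R` is functional
  have hmem : ∀ y : ext ψ, ∃ x : ext φ, R x y := fun y ↦ by
    obtain ⟨x, hx, hxy⟩ := (hψ _ _).1 y.2
    exact ⟨⟨x, hx⟩, hxy⟩
  choose F hF using hmem
  refine (Cardinal.mk_le_of_injective (f := F) fun y y' hyy' ↦ ?_).trans_lt hφ
  exact Subtype.ext (hfun _ _ _ (hF y) (hyy' ▸ hF y'))

/-! ### The numbering of programs -/

theorem OracleCode.ofNat_pair (c d : ℕ) :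
    ofNat (4 * Nat.pair c d + 5) = pair (ofNat c) (ofNat d) := by
  rw [ofNat]
  have h : 4 * Nat.pair c d / 4 = Nat.pair c d := by omega
  simp [h]

theorem OracleCode.ofNat_comp (c d : ℕ) :
    ofNat (4 * Nat.pair c d + 6) = comp (ofNat c) (ofNat d) := by
  rw [ofNat]
  have h : (4 * Nat.pair c d + 1) / 4 = Nat.pair c d := by omega
  have h' : (4 * Nat.pair c d + 1) % 4 = 1 := by omega
  simp [h, h']

theorem OracleCode.ofNat_prec (c d : ℕ) :
    ofNat (4 * Nat.pair c d + 7) = prec (ofNat c) (ofNat d) := by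
  rw [ofNat]
  have h : (4 * Nat.pair c d + 2) / 4 = Nat.pair c d := by omega
  have h' : (4 * Nat.pair c d + 2) % 4 = 2 := by omega
  simp [h, h']

theorem OracleCode.ofNat_rfind (c : ℕ) : ofNat (4 * c + 8) = rfind (ofNat c) := by
  rw [ofNat]
  have h : (4 * c + 3) / 4 = c := by omega
  have h' : (4 * c + 3) % 4 = 3 := by omega
  simp [h, h']

theorem OracleCode.ofNat_surjective : Function.Surjective ofNat := by
  intro p
  induction p with
  | zero => exact ⟨0, by simp [ofNat]⟩
  | succ => exact ⟨1, by simp [ofNat]⟩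
  | left => exact ⟨2, by simp [ofNat]⟩
  | right => exact ⟨3, by simp [ofNat]⟩
  | oracle => exact ⟨4, by simp [ofNat]⟩
  | pair _ _ hc hd =>
    obtain ⟨c, rfl⟩ := hc
    obtain ⟨d, rfl⟩ := hd
    exact ⟨_, ofNat_pair c d⟩
  | comp _ _ hc hd =>
    obtain ⟨c, rfl⟩ := hc
    obtain ⟨d, rfl⟩ := hd
    exact ⟨_, ofNat_comp c d⟩
  | prec _ _ hc hd =>
    obtain ⟨c, rfl⟩ := hc
    obtain ⟨d, rfl⟩ := hd
    exact ⟨_, ofNat_prec c d⟩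
  | rfind _ hc =>
    obtain ⟨c, rfl⟩ := hc
    exact ⟨_, ofNat_rfind c⟩

/-- Every index is `0, …, 4` or the index of a compound program with smaller indices; this is the
case split for an induction on indices. -/
theorem OracleCode.index_cases (e : ℕ) :
    e = 0 ∨ e = 1 ∨ e = 2 ∨ e = 3 ∨ e = 4 ∨
      (∃ c d, c < e ∧ d < e ∧ (e = 4 * Nat.pair c d + 5 ∨ e = 4 * Nat.pair c d + 6 ∨
        e = 4 * Nat.pair c d + 7)) ∨
      ∃ c, c < e ∧ e = 4 * c + 8 := by
  rcases Nat.lt_or_ge e 5 with h | h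
  · omega
  obtain ⟨n, rfl⟩ := Nat.exists_eq_add_of_le' h
  have h1 := Nat.unpair_left_le (n / 4)
  have h2 := Nat.unpair_right_le (n / 4)
  have h3 := Nat.pair_unpair (n / 4)
  by_cases hr : n % 4 = 3
  · exact .inr (.inr (.inr (.inr (.inr (.inr ⟨n / 4, by omega, by omega⟩)))))
  · refine .inr (.inr (.inr (.inr (.inr (.inl
      ⟨(n / 4).unpair.1, (n / 4).unpair.2, by omega, by omega, ?_⟩)))))
    rw [h3]
    omega

/-! ### The computation rules of `Φ` -/

theorem Phi_zero (x : Set ℕ) (n : ℕ) : Phi 0 x n = Part.some 0 := by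
  simp [Phi, OracleCode.ofNat, OracleCode.eval]

theorem Phi_one (x : Set ℕ) (n : ℕ) : Phi 1 x n = Part.some (n + 1) := by
  simp [Phi, OracleCode.ofNat, OracleCode.eval]

theorem Phi_two (x : Set ℕ) (n : ℕ) : Phi 2 x n = Part.some n.unpair.1 := by
  simp [Phi, OracleCode.ofNat, OracleCode.eval]

theorem Phi_three (x : Set ℕ) (n : ℕ) : Phi 3 x n = Part.some n.unpair.2 := by
  simp [Phi, OracleCode.ofNat, OracleCode.eval]

theorem mem_charFun {x : Set ℕ} {n r : ℕ} :
    r ∈ charFun x n ↔ (n ∈ x ∧ r = 1) ∨ (n ∉ x ∧ r = 0) := by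
  by_cases h : n ∈ x <;> simp [charFun, h]

theorem mem_Phi_four {x : Set ℕ} {n r : ℕ} :
    r ∈ Phi 4 x n ↔ (n ∈ x ∧ r = 1) ∨ (n ∉ x ∧ r = 0) := by
  rw [← mem_charFun]
  simp [Phi, OracleCode.ofNat, OracleCode.eval]

theorem mem_Phi_pair {x : Set ℕ} {c d n r : ℕ} :
    r ∈ Phi (4 * Nat.pair c d + 5) x n ↔
      ∃ s t, s ∈ Phi c x n ∧ t ∈ Phi d x n ∧ r = Nat.pair s t := by
  simp [Phi, OracleCode.ofNat_pair, OracleCode.eval, Seq.seq, eq_comm]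

theorem mem_Phi_comp {x : Set ℕ} {c d n r : ℕ} :
    r ∈ Phi (4 * Nat.pair c d + 6) x n ↔ ∃ s, s ∈ Phi d x n ∧ r ∈ Phi c x s := by
  simp only [Phi, OracleCode.ofNat_comp, OracleCode.eval]
  exact Part.mem_bind_iff

theorem mem_Phi_prec_zero {x : Set ℕ} {c d n r : ℕ} :
    r ∈ Phi (4 * Nat.pair c d + 7) x (Nat.pair n 0) ↔ r ∈ Phi c x n := by
  simp [Phi, OracleCode.ofNat_prec, OracleCode.eval]

theorem mem_Phi_prec_succ {x : Set ℕ} {c d n y r : ℕ} :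
    r ∈ Phi (4 * Nat.pair c d + 7) x (Nat.pair n (y + 1)) ↔
      ∃ s, s ∈ Phi (4 * Nat.pair c d + 7) x (Nat.pair n y) ∧
        r ∈ Phi d x (Nat.pair n (Nat.pair y s)) := by
  simp [Phi, OracleCode.ofNat_prec, OracleCode.eval]

theorem mem_Phi_rfind {x : Set ℕ} {c n r : ℕ} :
    r ∈ Phi (4 * c + 8) x n ↔ 0 ∈ Phi c x (Nat.pair n r) ∧
      ∀ j, j < r → ∃ s, s ∈ Phi c x (Nat.pair n j) ∧ ¬ s = 0 := by
  simp only [Phi, OracleCode.ofNat_rfind, OracleCode.eval]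
  refine Nat.mem_rfind.trans ?_
  simp

/-! ### Definability of `Φ` and of the jump -/

/-- A set of codes `⟨e, ⟨n, r⟩⟩` is closed under the computation rules with oracle `x` if it
satisfies, for every program, the clause which puts `⟨e, ⟨n, r⟩⟩` into the graph of
`(e, n) ↦ Φ_e^x(n)`. All clauses are positive in `P`. -/
def EvalClosed (x P : Set ℕ) : Prop :=
  (∀ n, Nat.pair 0 (Nat.pair n 0) ∈ P) ∧
  (∀ n, Nat.pair 1 (Nat.pair n (n + 1)) ∈ P) ∧
  (∀ s t, Nat.pair 2 (Nat.pair (Nat.pair s t) s) ∈ P) ∧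
  (∀ s t, Nat.pair 3 (Nat.pair (Nat.pair s t) t) ∈ P) ∧
  (∀ n, n ∈ x → Nat.pair 4 (Nat.pair n 1) ∈ P) ∧
  (∀ n, ¬ n ∈ x → Nat.pair 4 (Nat.pair n 0) ∈ P) ∧
  (∀ c d n s t, Nat.pair c (Nat.pair n s) ∈ P → Nat.pair d (Nat.pair n t) ∈ P →
    Nat.pair (4 * Nat.pair c d + 5) (Nat.pair n (Nat.pair s t)) ∈ P) ∧
  (∀ c d n s r, Nat.pair d (Nat.pair n s) ∈ P → Nat.pair c (Nat.pair s r) ∈ P →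
    Nat.pair (4 * Nat.pair c d + 6) (Nat.pair n r) ∈ P) ∧
  (∀ c d n r, Nat.pair c (Nat.pair n r) ∈ P →
    Nat.pair (4 * Nat.pair c d + 7) (Nat.pair (Nat.pair n 0) r) ∈ P) ∧
  (∀ c d n y s r, Nat.pair (4 * Nat.pair c d + 7) (Nat.pair (Nat.pair n y) s) ∈ P →
    Nat.pair d (Nat.pair (Nat.pair n (Nat.pair y s)) r) ∈ P →
    Nat.pair (4 * Nat.pair c d + 7) (Nat.pair (Nat.pair n (y + 1)) r) ∈ P) ∧
  (∀ c n r, Nat.pair c (Nat.pair (Nat.pair n r) 0) ∈ P →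
    (∀ j, j < r → ∃ s, Nat.pair c (Nat.pair (Nat.pair n j) s) ∈ P ∧ ¬ s = 0) →
    Nat.pair (4 * c + 8) (Nat.pair n r) ∈ P)

theorem evalClosed_graph (x : Set ℕ) :
    EvalClosed x {p | p.unpair.2.unpair.2 ∈ Phi p.unpair.1 x p.unpair.2.unpair.1} := by
  simp only [EvalClosed, Set.mem_ofPred_eq, Nat.unpair_pair]
  refine ⟨fun n ↦ ?_, fun n ↦ ?_, fun s t ↦ ?_, fun s t ↦ ?_, fun n hn ↦ ?_, fun n hn ↦ ?_,
    fun c d n s t hs ht ↦ ?_, fun c d n s r hs hr ↦ ?_, fun c d n r hr ↦ ?_,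
    fun c d n y s r hs hr ↦ ?_, fun c n r hr hj ↦ ?_⟩
  · simp [Phi_zero]
  · simp [Phi_one]
  · simp [Phi_two]
  · simp [Phi_three]
  · simp [mem_Phi_four, hn]
  · simp [mem_Phi_four, hn]
  · exact mem_Phi_pair.2 ⟨s, t, hs, ht, rfl⟩
  · exact mem_Phi_comp.2 ⟨s, hs, hr⟩
  · exact mem_Phi_prec_zero.2 hr
  · exact mem_Phi_prec_succ.2 ⟨s, hs, hr⟩
  · exact mem_Phi_rfind.2 ⟨hr, hj⟩

theorem EvalClosed.mem_of_mem_Phi {x P : Set ℕ} (hP : EvalClosed x P) (e : ℕ) :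
    ∀ n r, r ∈ Phi e x n → Nat.pair e (Nat.pair n r) ∈ P := by
  obtain ⟨h0, h1, h2, h3, h4, h4', hpair, hcomp, hprec0, hprec, hrfind⟩ := hP
  induction e using Nat.strong_induction_on with
  | _ e ih =>
  intro n r hr
  rcases OracleCode.index_cases e with
    rfl | rfl | rfl | rfl | rfl | ⟨c, d, hc, hd, rfl | rfl | rfl⟩ | ⟨c, hc, rfl⟩
  · obtain rfl : r = 0 := by simpa [Phi_zero] using hr
    exact h0 n
  · obtain rfl : r = n + 1 := by simpa [Phi_one] using hr
    exact h1 n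
  · obtain rfl : r = n.unpair.1 := by simpa [Phi_two] using hr
    simpa using h2 n.unpair.1 n.unpair.2
  · obtain rfl : r = n.unpair.2 := by simpa [Phi_three] using hr
    simpa using h3 n.unpair.1 n.unpair.2
  · rcases mem_Phi_four.1 hr with ⟨hn, rfl⟩ | ⟨hn, rfl⟩
    · exact h4 n hn
    · exact h4' n hn
  · obtain ⟨s, t, hs, ht, rfl⟩ := mem_Phi_pair.1 hr
    exact hpair _ _ _ _ _ (ih c hc _ _ hs) (ih d hd _ _ ht)
  · obtain ⟨s, hs, hr⟩ := mem_Phi_comp.1 hr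
    exact hcomp _ _ _ _ _ (ih d hd _ _ hs) (ih c hc _ _ hr)
  · obtain ⟨n, y, rfl⟩ : ∃ a y, n = Nat.pair a y := ⟨_, _, n.pair_unpair.symm⟩
    induction y generalizing r with
    | zero => exact hprec0 _ _ _ _ (ih c hc _ _ (mem_Phi_prec_zero.1 hr))
    | succ y ihy =>
      obtain ⟨s, hs, hr⟩ := mem_Phi_prec_succ.1 hr
      exact hprec _ _ _ _ _ _ (ihy _ hs) (ih d hd _ _ hr)
  · obtain ⟨hr, hj⟩ := mem_Phi_rfind.1 hr
    refine hrfind _ _ _ (ih c hc _ _ hr) fun j hjr ↦ ?_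
    obtain ⟨s, hs, hs0⟩ := hj j hjr
    exact ⟨s, ih c hc _ _ hs, hs0⟩

/-- The graph of `Φ` is the least set closed under the computation rules; quantifying over all
closed sets defines it in second-order arithmetic. -/
theorem mem_Phi_iff {e n r : ℕ} {x : Set ℕ} :
    r ∈ Phi e x n ↔ ∀ P, EvalClosed x P → Nat.pair e (Nat.pair n r) ∈ P :=
  ⟨fun h _ hP ↦ hP.mem_of_mem_Phi e n r h, fun h ↦ by simpa using h _ (evalClosed_graph x)⟩

namespace SecondOrderArith

variable {A : Set (Set ℕ)} {k m : ℕ}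

theorem definable_evalClosed (i j : Fin m) :
    Definable A fun (_ : Fin k → ℕ) (w : Fin m → Set ℕ) ↦ EvalClosed (w i) (w j) := by
  unfold EvalClosed
  repeat' with_reducible first
    | apply Definable.and
    | apply Definable.forallNum
    | apply Definable.existsNum
    | apply Definable.not
    | apply Definable.imp
    | apply Definable.mem
    | apply Definable.lt
    | apply Definable.eq
    | apply DefinableFun.pair
    | exact DefinableFun.var _
    | exact DefinableFun.const _
    | apply DefinableFun.add
    | apply DefinableFun.mul

theorem definable_mem_Phi {f g h : (Fin k → ℕ) → (Fin m → Set ℕ) → ℕ} (hf : DefinableFun A f)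
    (hg : DefinableFun A g) (hh : DefinableFun A h) (i : Fin m) :
    Definable A fun v w ↦ h v w ∈ Phi (f v w) (w i) (g v w) := by
  simp only [mem_Phi_iff]
  refine .forallSet (.imp (definable_evalClosed i.succ 0) (.mem (.pair ?_ (.pair ?_ ?_)) 0))
  · exact Definable.rename id Fin.succ hf
  · exact Definable.rename id Fin.succ hg
  · exact Definable.rename id Fin.succ hh

theorem definable_eq_turingJump (i j : Fin m) :
    Definable A fun (_ : Fin k → ℕ) (w : Fin m → Set ℕ) ↦ w j = turingJump (w i) := by
  simp only [Set.ext_iff, turingJump, Set.mem_ofPred_eq, Part.dom_iff_mem]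
  exact .forallNum (.iff (.mem (.var 0) j)
    (.existsNum (definable_mem_Phi (.var 1) (.var 1) (.var 0) i)))

end SecondOrderArith

/-! ### Turing reductions and injectivity of the jump -/

theorem exists_Phi_eq_of_turingReducible {f : ℕ →. ℕ} {a : Set ℕ}
    (h : TuringReducible f (charFun a)) : ∃ e, Phi e a = f := by
  suffices ∃ p : OracleCode, p.eval (charFun a) = f by
    obtain ⟨p, hp⟩ := this
    obtain ⟨e, rfl⟩ := OracleCode.ofNat_surjective p
    exact ⟨e, hp⟩
  rw [TuringReducible, RecursiveIn.iff_nat] at h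
  induction h with
  | zero => exact ⟨.zero, rfl⟩
  | succ => exact ⟨.succ, rfl⟩
  | left => exact ⟨.left, rfl⟩
  | right => exact ⟨.right, rfl⟩
  | oracle g hg => exact ⟨.oracle, hg.symm⟩
  | pair _ _ hf hh =>
    obtain ⟨p, rfl⟩ := hf
    obtain ⟨q, rfl⟩ := hh
    exact ⟨.pair p q, rfl⟩
  | comp _ _ hf hh =>
    obtain ⟨p, rfl⟩ := hf
    obtain ⟨q, rfl⟩ := hh
    exact ⟨.comp p q, rfl⟩
  | prec _ _ hf hh =>
    obtain ⟨p, rfl⟩ := hf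
    obtain ⟨q, rfl⟩ := hh
    exact ⟨.prec p q, rfl⟩
  | rfind _ hf =>
    obtain ⟨p, rfl⟩ := hf
    exact ⟨.rfind p, rfl⟩

/-- For each `n` there is an index `e` such that `Φ_e^a` has domain `ω` or `∅` according to whether
`n ∈ a`: search for a zero of `1 - a(n)`. -/
theorem exists_mem_turingJump_iff (n : ℕ) : ∃ e, ∀ a, e ∈ turingJump a ↔ n ∈ a := by
  have hconst : ∃ p : OracleCode, ∀ g k, p.eval g k = Part.some n := by
    induction n with
    | zero => exact ⟨.zero, fun _ _ ↦ rfl⟩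
    | succ n ih =>
      obtain ⟨p, hp⟩ := ih
      exact ⟨.comp .succ p, fun g k ↦ by simp [OracleCode.eval, hp]⟩
  obtain ⟨p, hp⟩ := hconst
  -- primitive recursion with value `1` at `0` and value `0` elsewhere computes `1 - a(n)`
  obtain ⟨e, he⟩ := OracleCode.ofNat_surjective (.rfind
    (.comp (.prec (.comp .succ .zero) .zero) (.pair .zero (.comp .oracle p))))
  refine ⟨e, fun a ↦ ?_⟩
  change (Phi e a e).Dom ↔ _
  simp only [Phi, he, OracleCode.eval]
  refine Nat.rfind_dom.trans ?_
  by_cases h : n ∈ a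
  · have hbind : (Part.some n >>= charFun a) = Part.some 1 :=
      (Part.bind_some _ _).trans (by simp [charFun, h])
    simp only [hp, hbind]
    simp [h, Seq.seq]
  · have hbind : (Part.some n >>= charFun a) = Part.some 0 :=
      (Part.bind_some _ _).trans (by simp [charFun, h])
    simp only [hp, hbind]
    simp [h, Seq.seq]

theorem turingJump_injective : Function.Injective turingJump := by
  intro a b h
  ext n
  obtain ⟨e, he⟩ := exists_mem_turingJump_iff n
  rw [← he a, ← he b, h]

/-! ### Typicality under Turing reductions and the jump -/

open SecondOrderArith in
theorem not_isTypicalOver_of_turingReducible {A : Set (Set ℕ)} {a b : Set ℕ}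
    (ha : ¬ IsTypicalOver A a) (h : TuringReducible (charFun b) (charFun a)) :
    ¬ IsTypicalOver A b := by
  obtain ⟨e, he⟩ := exists_Phi_eq_of_turingReducible h
  refine not_isTypicalOver_of_definable (R := fun x y ↦ ∀ n, n ∈ y ↔ 1 ∈ Phi e x n)
    (.forallNum (.iff (.mem (.var 0) 1) (definable_mem_Phi (.const e) (.var 0) (.const 1) 0)))
    (fun x y y' hy hy' ↦ Set.ext fun n ↦ (hy n).trans (hy' n).symm) (fun n ↦ ?_) ha
  simp [he, mem_charFun]

open SecondOrderArith in
theorem isTypicalOver_turingJump_iff {A : Set (Set ℕ)} {a : Set ℕ} :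
    IsTypicalOver A (turingJump a) ↔ IsTypicalOver A a := by
  rw [← not_iff_not]
  constructor
  · refine not_isTypicalOver_of_definable (R := fun x y ↦ x = turingJump y)
      (definable_eq_turingJump 1 0) (fun x y y' hy hy' ↦ ?_) rfl
    exact turingJump_injective (hy.symm.trans hy')
  · exact not_isTypicalOver_of_definable (R := fun x y ↦ y = turingJump x)
      (definable_eq_turingJump 0 1) (fun x y y' hy hy' ↦ hy.trans hy'.symm) rfl

theorem theorem3p7 {n : ℕ} (a b : Set ℕ) (c : Fin n → Set ℕ) :
    (¬ Tp a c → TuringReducible (charFun b) (charFun a) → ¬ Tp b c) ∧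
    (Tp a c → TuringEquivalent (charFun b) (charFun a) → Tp b c) ∧
    (Tp a c ↔ Tp (turingJump a) c) :=
  ⟨not_isTypicalOver_of_turingReducible,
    fun ha h ↦ by_contra fun hb ↦ not_isTypicalOver_of_turingReducible hb h.2 ha,
    isTypicalOver_turingJump_iff.symm⟩
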